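/- Notation. Put $[x,y]=x^{-1}y^{-1}xy$ and $[x,y,z]=[[x,y],z]$. Outer commutator words are defined inductively: each variable $x_i$ is one, and if $u$ and $v$ are outer commutator words in disjoint sets of variables, then $[u,v]$ is one. For a set $V$ of words and a group $G$, let $T(G)$ be the set of all values in $G$ of words of $V$, let $V(G)=\langle T(G)\rangle$ be the verbal subgroup, and let $V^*(G)$ be the marginal subgroup, i.e. the set of all $a\in G$ with $v(g_1,\dots,g_ia,\dots,g_s)=v(g_1,\dots,g_s)$ for all $v\in V$, all $g_1,\dots,g_s\in G$ and all $i$. If $G\cong F/R$ is a free presentation, put $$\mathcal V\tilde B_0(G)=\frac{R\cap V(F)}{\langle T(F)\cap R\rangle}.$$ A VP cover of $Q$ (with respect to the variety $\mathcal V$ defined by $V$) is an extension $1\to N\to E\xrightarrow{\pi} Q\to 1$ such that: whenever $v\in V$ and $v(q_1,\dots,q_s)=1$ in $Q$, there are $g_i\in E$ with $\pi(g_i)=q_i$ and $v(g_1,\dots,g_s)=1$; the image of $N$ lies in $V^*(E)\cap V(E)$; and $N\cong\mathcal V\tilde B_0(Q)$. Theorem 3.4. Let $w=w(x_1,\dots,x_r)$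 be an outer commutator word, and let $\mathcal V$ be the variety defined by the single word $[w,x_{r+1},x_{r+2}]$, where $x_{r+1},x_{r+2}$ are distinct variables that do not occur in $w$. Let $W(\cdot)$ denote the verbal subgroup for $w$. Let $G$ be a finite group with a VP cover $1\to L\to G^*\to G\to 1$ with respect to $\mathcal V$, and regard $L$ as a subgroup of $G^*$. Let $H\le G$ be a subgroup of index $n$, and let $B$ be a subgroup of $G^*$ with $L\le B$ and $B/L\cong H$. Identify $\mathcal V\tilde B_0(G)$ with $L$ by any isomorphism, and let $\mathcal V\tilde B_0(G)^n$ be its subgroup of $n$-th powers. Then the subgroup $[W(B),\mathcal V\tilde B_0(G)^n]$ of $G^*$ is isomorphic to a subgroup of $\mathcal V\tilde B_0(H)$. This holds for every choice of the free presentations of $G$ and $H$ used to compute $\mathcal V\tilde B_0(G)$ and $\mathcal V\tilde B_0(H)$. -/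

import Mathlib

namespace VPCover

/-- The commutator `[x, y] = x⁻¹ y⁻¹ x y`. -/
def commElt {G : Type*} [Group G] (x y : G) : G := x⁻¹ * y⁻¹ * x * y

/-- Words are elements of the free group on countably many letters `x₀, x₁, …`.
`IsOuterCommutator w S` says that `w` is an outer commutator word in exactly the letters `xᵢ`,
`i ∈ S`, each of them used once; its weight is the cardinality of `S`. -/
inductive IsOuterCommutator : FreeGroup ℕ → Finset ℕ → Prop
  | var (i : ℕ) : IsOuterCommutator (FreeGroup.of i) {i}
  | comm {u v : FreeGroup ℕ} {S T : Finset ℕ} (hu : IsOuterCommutator u S)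
      (hv : IsOuterCommutator v T) (hST : Disjoint S T) :
      IsOuterCommutator (commElt u v) (S ∪ T)

/-- The word `[w, xᵢ, xⱼ] = [[w, xᵢ], xⱼ]`. -/
def centerByCenterBy (w : FreeGroup ℕ) (i j : ℕ) : FreeGroup ℕ :=
  commElt (commElt w (FreeGroup.of i)) (FreeGroup.of j)

/-- `T(G)`: the set of all values in `G` of the words in `V`. -/
def wordValues (V : Set (FreeGroup ℕ)) (G : Type*) [Group G] : Set G :=
  {x | ∃ v ∈ V, ∃ g : ℕ → G, FreeGroup.lift g v = x}

/-- The verbal subgroup `V(G)`. -/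
def verbal (V : Set (FreeGroup ℕ)) (G : Type*) [Group G] : Subgroup G :=
  Subgroup.closure (wordValues V G)

/-- The marginal subgroup `V*(G)`: the elements `a` such that
`v(g₁, …, gᵢ a, …, gₛ) = v(g₁, …, gᵢ, …, gₛ)` for all `v ∈ V`, all `g` and all `i`. -/
def marginal (V : Set (FreeGroup ℕ)) (G : Type*) [Group G] : Subgroup G where
  carrier := {a | ∀ v ∈ V, ∀ (g : ℕ → G) (i : ℕ),
    FreeGroup.lift (Function.update g i (g i * a)) v = FreeGroup.lift g v}
  one_mem' := by
    intro v _ g i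
    simp
  mul_mem' := by
    intro a b ha hb v hv g i
    have h := hb v hv (Function.update g i (g i * a)) i
    simp only [Function.update_self, Function.update_idem, mul_assoc] at h
    exact h.trans (ha v hv g i)
  inv_mem' := by
    intro a ha v hv g i
    have h := ha v hv (Function.update g i (g i * a⁻¹)) i
    simp only [Function.update_self, Function.update_idem, inv_mul_cancel_right,
      Function.update_eq_self] at h
    exact h.symm

theorem conj_mem_wordValues {V : Set (FreeGroup ℕ)} {G : Type*} [Group G] {x : G}
    (hx : x ∈ wordValues V G) (c : G) : c * x * c⁻¹ ∈ wordValues V G := by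
  obtain ⟨v, hv, g, rfl⟩ := hx
  refine ⟨v, hv, fun i => MulAut.conj c (g i), ?_⟩
  have h : FreeGroup.lift (fun i => MulAut.conj c (g i)) =
      (MulAut.conj c).toMonoidHom.comp (FreeGroup.lift g) := by
    ext i
    simp
  rw [h]
  simp

/-- For `p : F → G`, with kernel `R`, the subgroup `⟨T(F) ∩ R⟩` of `F`. -/
def trivialValues (V : Set (FreeGroup ℕ)) {F G : Type*} [Group F] [Group G] (p : F →* G) :
    Subgroup F :=
  Subgroup.closure (wordValues V F ∩ (p.ker : Set F))

instance trivialValues_normal (V : Set (FreeGroup ℕ)) {F G : Type*} [Group F] [Group G]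
    (p : F →* G) : (trivialValues V p).Normal := by
  have h : Subgroup.normalClosure (wordValues V F ∩ (p.ker : Set F)) = trivialValues V p := by
    refine le_antisymm ?_ Subgroup.closure_le_normalClosure
    refine (Subgroup.closure_le _).2 fun x hx => ?_
    obtain ⟨a, ha, hax⟩ := Group.mem_conjugatesOfSet_iff.1 hx
    obtain ⟨c, rfl⟩ := isConj_iff.1 hax
    exact Subgroup.subset_closure
      ⟨conj_mem_wordValues ha.1 c, (MonoidHom.normal_ker p).conj_mem a ha.2 c⟩
  rw [← h]
  infer_instance

/-- The `B̃₀`-invariant `(R ∩ V(F)) / ⟨T(F) ∩ R⟩` of `G` with respect to the variety defined by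
`V`, computed from a free presentation `p : F → G` (surjective, with `F` free) with kernel `R`. -/
abbrev BInvariant (V : Set (FreeGroup ℕ)) {F G : Type*} [Group F] [Group G] (p : F →* G) :
    Type _ :=
  ↥(p.ker ⊓ verbal V F) ⧸ (trivialValues V p).subgroupOf (p.ker ⊓ verbal V F)

/-- VP extensions: every trivial value in `Q` of a word of `V` lifts to a trivial value in `E` of
the same word. -/
def IsVPExtension (V : Set (FreeGroup ℕ)) {N E Q : Type*} [Group N] [Group E] [Group Q]
    (S : GroupExtension N E Q) : Prop :=
  ∀ v ∈ V, ∀ q : ℕ → Q, FreeGroup.lift q v = 1 →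
    ∃ g : ℕ → E, (∀ i, S.rightHom (g i) = q i) ∧ FreeGroup.lift g v = 1

/-- VP covers `1 → N → E → Q → 1`: the marginal VP extensions that are `𝒱`-stem and have a kernel
isomorphic to the `B̃₀`-invariant of `Q`, computed from the free presentation `p` of `Q`. -/
structure IsVPCover (V : Set (FreeGroup ℕ)) {N E Q F : Type*} [Group N] [Group E] [Group Q]
    [Group F] (S : GroupExtension N E Q) (p : F →* Q) : Prop where
  vp : IsVPExtension V S
  le_marginal : S.inl.range ≤ marginal V E
  le_verbal : S.inl.range ≤ verbal V E
  iso : Nonempty (BInvariant V p ≃* N)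

/-- `Aⁿ`: the subgroup of `A` generated by the `n`-th powers (for abelian `A`, the subgroup of all
`n`-th powers). -/
def powers (A : Type*) [Group A] (n : ℕ) : Subgroup A :=
  Subgroup.closure (Set.range fun a : A => a ^ n)

end VPCover

/-!
Write `V` for the word `[w, xᵢ, xⱼ]`, again an outer commutator word, so that
`V(E) = [W(E), E, E]` for every group `E`. The proof embeds `[W(B), Lⁿ]` in three steps.

*Transfer.* In a VP extension with marginal kernel `L`, a trivial value of `V` lifts to a trivial
value and two lifts have the same value, so `L` contains no nontrivial value of `V`. Let `R` be a
normal subgroup of a group `E` with this property. A value of `V` with an argument in `R` lies in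
`R`, hence is trivial. So `R` centralizes `[W(E), E]`, and `[W(E), R]` is central; by the three
subgroups lemma `[R, E]` centralizes `W(E)`. Apply this to `L` in `G*`. As
`L ≤ V(G*) ≤ [G*, G*]` and `L` is central modulo `[L, G*]`, the transfer `G* → B / [B, B]`, taken
modulo `[L, G*]`, shows that `Lⁿ ≤ [B, B] [L, G*]`. Hence
`[W(B), Lⁿ] ≤ [W(B), [B, B]] ≤ [W(B), B, B] = V(B)`
(`commutator_pow_index_mem`), and so `[W(B), Lⁿ] ≤ L ∩ V(B)`.

*Lifting presentations.* A free presentation of `H ≅ B / L` lifts to `B`, and this makes `L ∩ V(B)`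
a quotient of the `B̃₀`-invariant of `H` (`exists_hom_range_eq`).

*Finiteness.* It remains to see that the `B̃₀`-invariant of a finite group is finite abelian, since
a quotient of a finite abelian group embeds in that group. It lies in `V(E)` for
`E = F / ⟨T(F) ∩ R⟩`, in which the image of `R` has finite index and contains no nontrivial value
of `V`. For an arbitrary outer commutator word `V` this forces `V(E)` to be finite, by induction on
the word (`IsOuterCommutator.finite_verbal`). The inductive step is Baer's theorem that `[M, N]` is
finite if `M` and `N` are normal and each is centralized by a subgroup of finite index of the other
(`finite_commutator_of_relIndex_centralizer`). It is proved by applying Dietzmann's lemma in the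
semidirect product of `N` with the finite group of automorphisms that `M` induces on it.
-/

namespace VPCover

section

open scoped commutatorElement

/-! ### Finiteness of commutator subgroups -/

theorem finite_commutatorSet_of_finiteIndex_center {G : Type*} [Group G]
    [(Subgroup.center G).FiniteIndex] : Finite (commutatorSet G) := by
  have h : commutatorSet G ⊆ Set.range
      fun x : (G ⧸ Subgroup.center G) × (G ⧸ Subgroup.center G) => ⁅x.1.out, x.2.out⁆ := by
    rintro _ ⟨a, b, rfl⟩
    refine ⟨(QuotientGroup.mk a, QuotientGroup.mk b), ?_⟩
    obtain ⟨⟨c, hc⟩, hac⟩ := QuotientGroup.mk_out_eq_mul (Subgroup.center G) a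
    obtain ⟨⟨d, hd⟩, hbd⟩ := QuotientGroup.mk_out_eq_mul (Subgroup.center G) b
    rw [Subgroup.mem_center_iff] at hc hd
    have hc' : ∀ g : G, ⁅c, g⁆ = 1 := fun g =>
      commutatorElement_eq_one_iff_mul_comm.2 (hc g).symm
    have hd' : ∀ g : G, ⁅g, d⁆ = 1 := fun g => commutatorElement_eq_one_iff_mul_comm.2 (hd g)
    simp only [hac, hbd]
    rw [commutatorElement_mul_left_eq_conj_mul, hc', commutatorElement_mul_right_eq_mul_conj, hd']
    simp
  exact Set.Finite.to_subtype ((Set.finite_range _).subset h)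

theorem finite_of_closure_eq_top {G : Type*} [Group G] {S : Set G} (hS : S.Finite)
    (hconj : ∀ g, ∀ s ∈ S, g * s * g⁻¹ ∈ S) (htor : ∀ s ∈ S, IsOfFinOrder s)
    (htop : Subgroup.closure S = ⊤) : Finite G := by
  have : Finite S := hS
  have : Group.FG G := (Group.fg_iff).2 ⟨S, htop, hS⟩
  let _ : MulAction G S :=
    { smul := fun g s => ⟨g * s * g⁻¹, hconj g s s.2⟩
      one_smul := fun s => Subtype.ext (by change 1 * (s : G) * 1⁻¹ = s; simp)
      mul_smul := fun g h s => Subtype.ext (by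
        change g * h * (s : G) * (g * h)⁻¹ = g * (h * s * h⁻¹) * g⁻¹
        group) }
  -- An element that fixes the generators under conjugation is central, so the center has finite
  -- index; Schur's theorem then makes the commutator subgroup finite.
  have hker : (MulAction.toPermHom G S).ker ≤ Subgroup.center G := by
    intro g hg
    have hc : Subgroup.closure S ≤ Subgroup.centralizer {g} := by
      refine (Subgroup.closure_le _).2 fun s hs => ?_
      have h1 := congrArg Subtype.val (DFunLike.congr_fun (MonoidHom.mem_ker.1 hg) ⟨s, hs⟩)
      change g * s * g⁻¹ = s at h1
      rw [SetLike.mem_coe, Subgroup.mem_centralizer_singleton_iff]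
      exact (mul_inv_eq_iff_eq_mul.1 h1).symm
    rw [htop] at hc
    exact Subgroup.mem_center_iff.2 fun x =>
      Subgroup.mem_centralizer_singleton_iff.1 (hc (Subgroup.mem_top x))
  have : (Subgroup.center G).FiniteIndex := Subgroup.finiteIndex_of_le hker
  have : Finite (commutatorSet G) := finite_commutatorSet_of_finiteIndex_center
  have : Finite (commutator G) := inferInstance
  have hab : Finite (Abelianization G) := by
    have hsurj : Function.Surjective (Abelianization.of : G →* Abelianization G) :=
      QuotientGroup.mk_surjective
    have : Group.FG (Abelianization G) :=
      Group.fg_of_surjective (f := Abelianization.of) hsurj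
    refine CommGroup.finite_of_fg_isMulTorsion (Abelianization G) fun x => ?_
    have h1 : Subgroup.closure S ≤ (CommGroup.torsion (Abelianization G)).comap
        Abelianization.of :=
      (Subgroup.closure_le _).2 fun s hs => Abelianization.of.isOfFinOrder (htor s hs)
    obtain ⟨g, rfl⟩ := hsurj x
    rw [htop] at h1
    exact h1 (Subgroup.mem_top g)
  have : Finite (G ⧸ commutator G) := hab
  exact Finite.of_subgroup_quotient (commutator G)

/-- **Dietzmann's lemma**: a finite conjugation-invariant set of elements of finite order generates
a finite subgroup. -/
theorem finite_closure_of_conj_mem {G : Type*} [Group G] {S : Set G} (hS : S.Finite)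
    (hconj : ∀ g, ∀ s ∈ S, g * s * g⁻¹ ∈ S) (htor : ∀ s ∈ S, IsOfFinOrder s) :
    Finite (Subgroup.closure S) := by
  refine finite_of_closure_eq_top (S := ((↑) : Subgroup.closure S → G) ⁻¹' S)
    (hS.preimage Subtype.val_injective.injOn) (fun g s hs => hconj g s hs) (fun s hs => ?_)
    (Subgroup.closure_closure_coe_preimage)
  exact Function.Injective.isOfFinOrder_iff (f := Subgroup.subtype _) Subtype.val_injective |>.1
    (htor s hs)

/-- If a finite group `Q` acts on `N` with a subgroup of fixed points of finite index, then the
conjugates of `Q` in `N ⋊ Q` are finite in number and generate a finite subgroup. -/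
theorem finite_closure_conj_inr {N Q : Type*} [Group N] [Group Q] [Finite Q] (φ : Q →* MulAut N)
    (C : Subgroup N) [C.FiniteIndex] (hC : ∀ c ∈ C, ∀ q, φ q c = c) :
    Finite (Subgroup.closure {x : N ⋊[φ] Q |
      ∃ k a, x = k * SemidirectProduct.inr a * k⁻¹}) := by
  refine finite_closure_of_conj_mem ?_ ?_ ?_
  · refine (Set.finite_range fun x : (N ⧸ C) × Q =>
      (SemidirectProduct.inl x.1.out * SemidirectProduct.inr x.2 *
        (SemidirectProduct.inl x.1.out)⁻¹ : N ⋊[φ] Q)).subset ?_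
    rintro _ ⟨k, a, rfl⟩
    refine ⟨(QuotientGroup.mk k.left, k.right * a * k.right⁻¹), ?_⟩
    obtain ⟨⟨c, hc⟩, hkc⟩ := QuotientGroup.mk_out_eq_mul C k.left
    -- Fixed points of `Q` commute with `Q`, so only the coset of `k.left` modulo `C` matters.
    have hcomm : ∀ b : Q, (SemidirectProduct.inl c * SemidirectProduct.inr b *
        (SemidirectProduct.inl c)⁻¹ : N ⋊[φ] Q) = SemidirectProduct.inr b := by
      intro b
      rw [mul_inv_eq_iff_eq_mul]
      ext
      · simp [hC c hc]
      · simp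
    simp only [hkc]
    calc _ = (SemidirectProduct.inl k.left : N ⋊[φ] Q) * ((SemidirectProduct.inl c *
            SemidirectProduct.inr (k.right * a * k.right⁻¹) * (SemidirectProduct.inl c)⁻¹)) *
            (SemidirectProduct.inl k.left)⁻¹ := by
          rw [map_mul]; group
      _ = (SemidirectProduct.inl k.left * SemidirectProduct.inr k.right) *
            SemidirectProduct.inr a *
            (SemidirectProduct.inl k.left * SemidirectProduct.inr k.right)⁻¹ := by
          rw [hcomm]
          simp only [map_mul, map_inv]
          group
      _ = _ := by rw [SemidirectProduct.inl_left_mul_inr_right]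
  · rintro g _ ⟨k, a, rfl⟩
    exact ⟨g * k, a, by group⟩
  · rintro _ ⟨k, a, rfl⟩
    have h := MonoidHom.isOfFinOrder (MulAut.conj k).toMonoidHom
      (MonoidHom.isOfFinOrder (SemidirectProduct.inr : Q →* N ⋊[φ] Q) (isOfFinOrder_of_finite a))
    simpa using h

/-- If a finite group `Q` acts on `N` with a subgroup of fixed points of finite index, then
`[N, Q]` is finite. -/
theorem finite_closure_act_mul_inv {N Q : Type*} [Group N] [Group Q] [Finite Q]
    (φ : Q →* MulAut N) (C : Subgroup N) [C.FiniteIndex] (hC : ∀ c ∈ C, ∀ q, φ q c = c) :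
    Finite (Subgroup.closure {y : N | ∃ q x, y = φ q x * x⁻¹}) := by
  have hfin := finite_closure_conj_inr φ C hC
  set T := Subgroup.closure {x : N ⋊[φ] Q | ∃ k a, x = k * SemidirectProduct.inr a * k⁻¹}
    with hT
  have hle : Subgroup.closure {y : N | ∃ q x, y = φ q x * x⁻¹} ≤
      T.comap SemidirectProduct.inl := by
    refine (Subgroup.closure_le _).2 ?_
    rintro _ ⟨q, x, rfl⟩
    have h : (SemidirectProduct.inl (φ q x * x⁻¹) : N ⋊[φ] Q) =
        (1 * SemidirectProduct.inr q * 1⁻¹) * (SemidirectProduct.inl x *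
          SemidirectProduct.inr q⁻¹ * (SemidirectProduct.inl x)⁻¹) := by
      rw [map_mul, SemidirectProduct.inl_aut, map_inv, map_inv]
      group
    rw [SetLike.mem_coe, Subgroup.mem_comap, h]
    exact mul_mem (Subgroup.subset_closure ⟨_, _, rfl⟩) (Subgroup.subset_closure ⟨_, _, rfl⟩)
  exact Finite.of_injective
    (fun x : Subgroup.closure {y : N | ∃ q x, y = φ q x * x⁻¹} =>
      (⟨SemidirectProduct.inl (x : N), hle x.2⟩ : T))
    fun x y hxy => Subtype.ext (SemidirectProduct.inl_injective (congrArg Subtype.val hxy))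

/-- **Baer**: if each of the subgroups `M` and `N` is, up to finite index, centralized by the other
and `N` is normal, then `⁅M, N⁆` is finite: `M` acts on `N` through a finite group. -/
theorem finite_commutator_of_relIndex_centralizer {G : Type*} [Group G] (M N : Subgroup G)
    [N.Normal] (hM : (Subgroup.centralizer (N : Set G)).relIndex M ≠ 0)
    (hN : (Subgroup.centralizer (M : Set G)).relIndex N ≠ 0) : Finite ↥⁅M, N⁆ := by
  let φ : M →* MulAut N := MulAut.conjNormal.comp M.subtype
  have hφ : ∀ (m : M) (x : N), ((φ m x : N) : G) = m * x * (m : G)⁻¹ := fun m x => rfl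
  have hker : (Subgroup.centralizer (N : Set G)).subgroupOf M ≤ φ.ker := by
    intro m hm
    refine MonoidHom.mem_ker.2 (MulEquiv.ext fun x => Subtype.ext ?_)
    have h := Subgroup.mem_centralizer_iff.1 (Subgroup.mem_subgroupOf.1 hm) x x.2
    rw [hφ, ← h]
    simp
  have : ((Subgroup.centralizer (N : Set G)).subgroupOf M).FiniteIndex := ⟨hM⟩
  have : φ.ker.FiniteIndex := Subgroup.finiteIndex_of_le hker
  have : Finite φ.range :=
    (QuotientGroup.quotientKerEquivRange φ).toEquiv.finite_iff.1 inferInstance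
  have : ((Subgroup.centralizer (M : Set G)).subgroupOf N).FiniteIndex := ⟨hN⟩
  have hfin := finite_closure_act_mul_inv φ.range.subtype
    ((Subgroup.centralizer (M : Set G)).subgroupOf N) (by
      rintro c hc ⟨_, m, rfl⟩
      refine Subtype.ext ?_
      have h := Subgroup.mem_centralizer_iff.1 (Subgroup.mem_subgroupOf.1 hc) m m.2
      change ((φ m c : N) : G) = c
      rw [hφ, h]
      simp)
  set P := Subgroup.closure {y : N | ∃ q x, y = φ.range.subtype q x * x⁻¹}
  have hle : ⁅M, N⁆ ≤ P.map N.subtype :=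
    Subgroup.commutator_le.2 fun m hm x hx => ⟨φ ⟨m, hm⟩ ⟨x, hx⟩ * ⟨x, hx⟩⁻¹,
      Subgroup.subset_closure ⟨⟨φ ⟨m, hm⟩, ⟨m, hm⟩, rfl⟩, ⟨x, hx⟩, rfl⟩, rfl⟩
  have : Finite (P.map N.subtype) := inferInstanceAs (Finite (N.subtype '' (P : Set N)))
  exact Finite.of_injective _ (Subgroup.inclusion_injective hle)

/-- A quotient of a finite abelian group embeds in that group, by duality of finite abelian
groups. -/
theorem exists_injective_of_surjective {A Q : Type*} [CommGroup A] [Finite A] [CommGroup Q]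
    (f : A →* Q) (hf : Function.Surjective f) : ∃ g : Q →* A, Function.Injective g := by
  have : Finite Q := Finite.of_surjective f hf
  have : NeZero (Monoid.exponent A) := ⟨Monoid.exponent_ne_zero_of_finite⟩
  have : NeZero (Monoid.exponent Q) := ⟨Monoid.exponent_ne_zero_of_finite⟩
  obtain ⟨a⟩ := CommGroup.monoidHom_mulEquiv_of_hasEnoughRootsOfUnity A (AlgebraicClosure ℚ)
  obtain ⟨b⟩ := CommGroup.monoidHom_mulEquiv_of_hasEnoughRootsOfUnity Q (AlgebraicClosure ℚ)
  have hinj : Function.Injective (MonoidHom.compHom' f :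
      (Q →* (AlgebraicClosure ℚ)ˣ) →* (A →* (AlgebraicClosure ℚ)ˣ)) :=
    fun x y h => (MonoidHom.cancel_right hf).1 h
  exact ⟨a.toMonoidHom.comp ((MonoidHom.compHom' f).comp b.symm.toMonoidHom),
    a.injective.comp (hinj.comp b.symm.injective)⟩

/-! ### Verbal subgroups of commutator words -/

theorem commutatorElement_eq_conj_commElt {G : Type*} [Group G] (x y : G) :
    ⁅x, y⁆ = (y * x) * commElt x y * (y * x)⁻¹ := by
  simp only [commElt, commutatorElement_def]
  group

theorem map_commElt {G G' : Type*} [Group G] [Group G'] (f : G →* G') (x y : G) :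
    f (commElt x y) = commElt (f x) (f y) := by
  simp [commElt]

theorem commElt_mem_iff {G : Type*} [Group G] {D : Subgroup G} [D.Normal] {x y : G} :
    commElt x y ∈ D ↔ ⁅x, y⁆ ∈ D := by
  rw [commutatorElement_eq_conj_commElt, ← Subgroup.Normal.mem_comm_iff ‹_›, inv_mul_cancel_left]

theorem commutator_closure_le {G : Type*} [Group G] {S T : Set G} {D : Subgroup G} [D.Normal]
    (h : ∀ s ∈ S, ∀ t ∈ T, ⁅s, t⁆ ∈ D) :
    ⁅Subgroup.closure S, Subgroup.closure T⁆ ≤ D := by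
  have hmk : ∀ s t : G, ⁅s, t⁆ ∈ D ↔ Commute (s : G ⧸ D) (t : G ⧸ D) := by
    intro s t
    rw [← commutatorElement_eq_one_iff_commute, ← QuotientGroup.eq_one_iff]
    rfl
  simp only [hmk] at h
  refine Subgroup.commutator_le.2 fun x hx y hy => (hmk x y).2 ?_
  induction hx using Subgroup.closure_induction with
  | one => exact Commute.one_left _
  | mul x z _ _ hx hz => exact hx.mul_left hz
  | inv x _ hx => exact hx.inv_left
  | mem x hx =>
    induction hy using Subgroup.closure_induction with
    | one => exact Commute.one_right _
    | mul y z _ _ hy hz => exact hy.mul_right hz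
    | inv y _ hy => exact hy.inv_right
    | mem y hy => exact h x hx y hy

/-- A consequence of the three subgroups lemma. -/
theorem commutator_commutator_top_le {G : Type*} [Group G] {W D : Subgroup G} [D.Normal]
    (h : ⁅⁅W, (⊤ : Subgroup G)⁆, (⊤ : Subgroup G)⁆ ≤ D) :
    ⁅W, ⁅(⊤ : Subgroup G), ⊤⁆⁆ ≤ D := by
  have hmap : ∀ K : Subgroup G, K ≤ D ↔ K.map (QuotientGroup.mk' D) = ⊥ := by
    intro K
    rw [Subgroup.map_eq_bot_iff, QuotientGroup.ker_mk']
  rw [hmap, Subgroup.map_commutator, Subgroup.map_commutator] at h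
  rw [hmap, Subgroup.map_commutator, Subgroup.map_commutator, Subgroup.commutator_comm]
  refine Subgroup.commutator_commutator_eq_bot_of_rotate ?_ h
  rwa [Subgroup.commutator_comm (Subgroup.map _ ⊤)]

instance verbal_normal (V : Set (FreeGroup ℕ)) (G : Type*) [Group G] : (verbal V G).Normal := by
  have h : verbal V G = Subgroup.normalClosure (wordValues V G) := by
    refine le_antisymm Subgroup.closure_le_normalClosure ?_
    refine (Subgroup.closure_le _).2 fun x hx => ?_
    obtain ⟨a, ha, hax⟩ := Group.mem_conjugatesOfSet_iff.1 hx
    obtain ⟨c, rfl⟩ := isConj_iff.1 hax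
    exact Subgroup.subset_closure (conj_mem_wordValues ha c)
  rw [h]
  infer_instance

theorem map_mem_wordValues {V : Set (FreeGroup ℕ)} {G G' : Type*} [Group G] [Group G']
    (f : G →* G') {x : G} (hx : x ∈ wordValues V G) : f x ∈ wordValues V G' := by
  obtain ⟨v, hv, g, rfl⟩ := hx
  refine ⟨v, hv, fun k => f (g k), ?_⟩
  have h : FreeGroup.lift (fun k => f (g k)) = f.comp (FreeGroup.lift g) := by
    ext k
    simp
  rw [h]
  rfl

theorem exists_wordValues_of_surjective {V : Set (FreeGroup ℕ)} {G G' : Type*} [Group G]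
    [Group G'] {f : G →* G'} (hf : Function.Surjective f) {y : G'} (hy : y ∈ wordValues V G') :
    ∃ x ∈ wordValues V G, f x = y := by
  obtain ⟨v, hv, g, rfl⟩ := hy
  choose g' hg' using fun k => hf (g k)
  refine ⟨_, ⟨v, hv, g', rfl⟩, ?_⟩
  have h : FreeGroup.lift g = f.comp (FreeGroup.lift g') := by
    ext k
    simp [hg']
  rw [h]
  rfl

theorem map_verbal_le (V : Set (FreeGroup ℕ)) {G G' : Type*} [Group G] [Group G']
    (f : G →* G') : (verbal V G).map f ≤ verbal V G' := by
  rw [verbal, MonoidHom.map_closure]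
  refine Subgroup.closure_mono ?_
  rintro _ ⟨x, hx, rfl⟩
  exact map_mem_wordValues f hx

theorem map_verbal_of_surjective (V : Set (FreeGroup ℕ)) {G G' : Type*} [Group G] [Group G']
    {f : G →* G'} (hf : Function.Surjective f) : (verbal V G).map f = verbal V G' := by
  refine le_antisymm (map_verbal_le V f) ((Subgroup.closure_le _).2 fun y hy => ?_)
  obtain ⟨x, hx, rfl⟩ := exists_wordValues_of_surjective hf hy
  exact ⟨x, Subgroup.subset_closure hx, rfl⟩

theorem wordValues_of (k : ℕ) (G : Type*) [Group G] :
    wordValues {FreeGroup.of k} G = Set.univ :=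
  Set.eq_univ_of_forall fun x => ⟨_, rfl, fun _ => x, by simp⟩

theorem verbal_of (k : ℕ) (G : Type*) [Group G] : verbal {FreeGroup.of k} G = ⊤ := by
  rw [verbal, wordValues_of, Subgroup.closure_univ]

/-- The values of an outer commutator word depend only on the letters that occur in it. -/
theorem IsOuterCommutator.lift_congr {w : FreeGroup ℕ} {X : Finset ℕ}
    (hw : IsOuterCommutator w X) {G : Type*} [Group G] {g h : ℕ → G} (hgh : ∀ k ∈ X, g k = h k) :
    FreeGroup.lift g w = FreeGroup.lift h w := by
  induction hw with
  | var k => simpa using hgh k (by simp)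
  | comm _ _ _ ihu ihv =>
    rw [map_commElt, map_commElt, ihu fun k hk => hgh k (Finset.mem_union_left _ hk),
      ihv fun k hk => hgh k (Finset.mem_union_right _ hk)]

theorem IsOuterCommutator.centerByCenterBy {w : FreeGroup ℕ} {X : Finset ℕ}
    (hw : IsOuterCommutator w X) {i j : ℕ} (hi : i ∉ X) (hj : j ∉ X) (hij : i ≠ j) :
    IsOuterCommutator (centerByCenterBy w i j) (X ∪ {i} ∪ {j}) := by
  refine .comm (.comm hw (.var i) (by simpa using hi)) (.var j) ?_
  simp [hj, hij.symm]

section CommutatorWord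

variable {u v : FreeGroup ℕ} {X Y : Finset ℕ} (hu : IsOuterCommutator u X)
  (hv : IsOuterCommutator v Y) (hXY : Disjoint X Y)

include hu hv hXY

/-- As the letters of `u` and `v` are different, values of `u` and of `v` can be prescribed
independently. -/
theorem commElt_mem_wordValues {G : Type*} [Group G] {a b : G} (ha : a ∈ wordValues {u} G)
    (hb : b ∈ wordValues {v} G) : commElt a b ∈ wordValues {commElt u v} G := by
  obtain ⟨_, rfl, g, rfl⟩ := ha
  obtain ⟨_, rfl, h, rfl⟩ := hb
  refine ⟨_, rfl, fun k => if k ∈ X then g k else h k, ?_⟩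
  rw [map_commElt, hu.lift_congr (h := g) fun k hk => if_pos hk,
    hv.lift_congr (h := h) fun k hk => if_neg (Finset.disjoint_right.1 hXY hk)]

theorem verbal_commElt (G : Type*) [Group G] :
    verbal {commElt u v} G = ⁅verbal {u} G, verbal {v} G⁆ := by
  refine le_antisymm ((Subgroup.closure_le _).2 ?_) (commutator_closure_le fun a ha b hb => ?_)
  · rintro _ ⟨_, rfl, g, rfl⟩
    rw [map_commElt, SetLike.mem_coe, commElt_mem_iff]
    exact Subgroup.commutator_mem_commutator (Subgroup.subset_closure ⟨_, rfl, g, rfl⟩)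
      (Subgroup.subset_closure ⟨_, rfl, g, rfl⟩)
  · exact commElt_mem_iff.1 (Subgroup.subset_closure (commElt_mem_wordValues hu hv hXY ha hb))

theorem commutator_closure_inter_verbal_eq_bot {G : Type*} [Group G] {R : Subgroup G} [R.Normal]
    (hR : ∀ x ∈ wordValues {commElt u v} G, x ∈ R → x = 1) :
    ⁅Subgroup.closure (wordValues {u} G ∩ (R : Set G)), verbal {v} G⁆ = ⊥ := by
  refine le_bot_iff.1 (commutator_closure_le fun a ha b hb => ?_)
  refine commElt_mem_iff.1 (hR _ (commElt_mem_wordValues hu hv hXY ha.1 hb) ?_)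
  exact commElt_mem_iff.2 (Subgroup.commutator_le_left R ⊤
    (Subgroup.commutator_mem_commutator ha.2 (Subgroup.mem_top b)))

theorem commutator_verbal_closure_inter_eq_bot {G : Type*} [Group G] {R : Subgroup G} [R.Normal]
    (hR : ∀ x ∈ wordValues {commElt u v} G, x ∈ R → x = 1) :
    ⁅verbal {u} G, Subgroup.closure (wordValues {v} G ∩ (R : Set G))⁆ = ⊥ := by
  refine le_bot_iff.1 (commutator_closure_le fun a ha b hb => ?_)
  refine commElt_mem_iff.1 (hR _ (commElt_mem_wordValues hu hv hXY ha hb.1) ?_)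
  exact commElt_mem_iff.2 (Subgroup.commutator_le_right ⊤ R
    (Subgroup.commutator_mem_commutator (Subgroup.mem_top a) hb.2))

end CommutatorWord

/-! ### Finiteness of the `B̃₀`-invariant -/

/-- Factoring out `⟨T(F) ∩ R⟩` leaves no nontrivial value of `V` in the image of `R`. -/
theorem eq_one_of_mem_wordValues_quotient (V : Set (FreeGroup ℕ)) {F G : Type*} [Group F]
    [Group G] (p : F →* G) {x : F ⧸ trivialValues V p} (hx : x ∈ wordValues V _)
    (hxR : x ∈ p.ker.map (QuotientGroup.mk' (trivialValues V p))) : x = 1 := by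
  obtain ⟨f, hf, rfl⟩ := exists_wordValues_of_surjective (QuotientGroup.mk'_surjective _) hx
  obtain ⟨r, hr, hrf⟩ := hxR
  have hle : trivialValues V p ≤ p.ker := (Subgroup.closure_le _).2 fun x hx => hx.2
  have h := hle (QuotientGroup.eq.1 hrf)
  refine (QuotientGroup.eq_one_iff f).2 (Subgroup.subset_closure ⟨hf, ?_⟩)
  simpa using mul_mem hr h

/-- An outer commutator word that takes no nontrivial value in a normal subgroup of finite index
generates a finite verbal subgroup. For a commutator `[u, v]` of words, the values of `u` in `R`
commute with the values of `v`; induction applies to `u` after they are factored out, and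
similarly to `v`, so that Baer's theorem applies to the verbal subgroups of `u` and `v`. -/
theorem IsOuterCommutator.finite_verbal {w : FreeGroup ℕ} {X : Finset ℕ}
    (hw : IsOuterCommutator w X) {E : Type*} [Group E] (R : Subgroup E) [R.Normal]
    [R.FiniteIndex] (hR : ∀ x ∈ wordValues {w} E, x ∈ R → x = 1) : Finite (verbal {w} E) := by
  induction hw generalizing E with
  | var k =>
    have hbot : R = ⊥ := (Subgroup.eq_bot_iff_forall R).2 fun x hx =>
      hR x (by rw [wordValues_of]; trivial) hx
    have : Finite R := by rw [hbot]; infer_instance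
    have : Finite E := Finite.of_subgroup_quotient R
    infer_instance
  | @comm u v X Y hu hv hXY ihu ihv =>
    have key : ∀ {u : FreeGroup ℕ},
        (∀ {E : Type _} [Group E] (R : Subgroup E) [R.Normal] [R.FiniteIndex],
          (∀ x ∈ wordValues {u} E, x ∈ R → x = 1) → Finite (verbal {u} E)) →
        (trivialValues {u} (QuotientGroup.mk' R)).relIndex (verbal {u} E) ≠ 0 := by
      intro u ih
      set N := trivialValues {u} (QuotientGroup.mk' R) with hN
      have hsurj := QuotientGroup.mk'_surjective N
      have : (R.map (QuotientGroup.mk' N)).Normal := Subgroup.Normal.map ‹_› _ hsurj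
      have : (R.map (QuotientGroup.mk' N)).FiniteIndex :=
        ⟨fun h => R.index_ne_zero_of_finite
          (Nat.eq_zero_of_zero_dvd (h ▸ Subgroup.index_map_dvd R hsurj))⟩
      have hfin := ih (R.map (QuotientGroup.mk' N)) fun x hx hxR =>
        eq_one_of_mem_wordValues_quotient {u} (QuotientGroup.mk' R) hx (by simpa using hxR)
      rw [← map_verbal_of_surjective {u} hsurj] at hfin
      have h := Subgroup.relIndex_ker (K := verbal {u} E) (QuotientGroup.mk' N)
      rw [QuotientGroup.ker_mk'] at h
      rw [h]
      exact Nat.card_pos.ne'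
    rw [verbal_commElt hu hv hXY]
    refine finite_commutator_of_relIndex_centralizer _ _ (fun h => key ihu ?_)
      (fun h => key ihv ?_)
    · refine Nat.eq_zero_of_zero_dvd (h ▸ Subgroup.relIndex_dvd_of_le_left _ ?_)
      rw [trivialValues, QuotientGroup.ker_mk']
      exact Subgroup.commutator_eq_bot_iff_le_centralizer.1
        (commutator_closure_inter_verbal_eq_bot hu hv hXY hR)
    · refine Nat.eq_zero_of_zero_dvd (h ▸ Subgroup.relIndex_dvd_of_le_left _ ?_)
      rw [trivialValues, QuotientGroup.ker_mk']
      refine Subgroup.commutator_eq_bot_iff_le_centralizer.1 ?_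
      rw [Subgroup.commutator_comm]
      exact commutator_verbal_closure_inter_eq_bot hu hv hXY hR

theorem verbal_centerByCenterBy {w : FreeGroup ℕ} {X : Finset ℕ} (hw : IsOuterCommutator w X)
    {i j : ℕ} (hi : i ∉ X) (hj : j ∉ X) (hij : i ≠ j) (G : Type*) [Group G] :
    verbal {centerByCenterBy w i j} G =
      ⁅⁅verbal {w} G, (⊤ : Subgroup G)⁆, (⊤ : Subgroup G)⁆ := by
  have hX : Disjoint X {i} := by simpa using hi
  rw [centerByCenterBy, verbal_commElt (hw.comm (.var i) hX) (.var j) (by simp [hj, hij.symm]),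
    verbal_commElt hw (.var i) hX, verbal_of, verbal_of]

/-- The canonical homomorphism of the `B̃₀`-invariant of `G` to `F / ⟨T(F) ∩ R⟩`. -/
def BInvariant.toQuotient (V : Set (FreeGroup ℕ)) {F G : Type*} [Group F] [Group G]
    (p : F →* G) : BInvariant V p →* F ⧸ trivialValues V p :=
  QuotientGroup.map _ _ (p.ker ⊓ verbal V F).subtype le_rfl

theorem BInvariant.toQuotient_injective (V : Set (FreeGroup ℕ)) {F G : Type*} [Group F] [Group G]
    (p : F →* G) : Function.Injective (toQuotient V p) := by
  refine (injective_iff_map_eq_one _).2 fun x hx => ?_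
  obtain ⟨y, rfl⟩ := QuotientGroup.mk_surjective x
  exact (QuotientGroup.eq_one_iff _).2 (Subgroup.mem_subgroupOf.2
    ((QuotientGroup.eq_one_iff _).1 hx))

theorem BInvariant.toQuotient_mem (V : Set (FreeGroup ℕ)) {F G : Type*} [Group F] [Group G]
    (p : F →* G) (x : BInvariant V p) :
    toQuotient V p x ∈ p.ker.map (QuotientGroup.mk' (trivialValues V p)) ⊓ verbal V _ := by
  obtain ⟨⟨y, hy⟩, rfl⟩ := QuotientGroup.mk_surjective x
  exact ⟨⟨y, hy.1, rfl⟩, map_verbal_le V (QuotientGroup.mk' _) ⟨y, hy.2, rfl⟩⟩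

section Marginal

variable {w : FreeGroup ℕ} {X : Finset ℕ} (hw : IsOuterCommutator w X)
  {i j : ℕ} (hi : i ∉ X) (hj : j ∉ X) (hij : i ≠ j)

include hw hi hj hij

/-- A normal subgroup `R` without nontrivial values of `[w, xᵢ, xⱼ]` centralizes `[W(G), G]`. -/
theorem commutator_commutator_top_eq_bot {G : Type*} [Group G] {R : Subgroup G} [R.Normal]
    (hR : ∀ x ∈ wordValues {centerByCenterBy w i j} G, x ∈ R → x = 1) :
    ⁅⁅verbal {w} G, (⊤ : Subgroup G)⁆, R⁆ = ⊥ := by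
  have hX : Disjoint X {i} := by simpa using hi
  have h := commutator_verbal_closure_inter_eq_bot (hw.comm (.var i) hX) (.var j)
    (by simp [hj, hij.symm]) hR
  rwa [wordValues_of, Set.univ_inter, Subgroup.closure_eq, verbal_commElt hw (.var i) hX,
    verbal_of] at h

/-- If `R` is a normal subgroup without nontrivial values of `[w, xᵢ, xⱼ]`, then `[W(G), R]` is
central: it is generated by the values of `[w, xᵢ]` in `R`. -/
theorem commutator_verbal_commutator_top_eq_bot {G : Type*} [Group G] {R : Subgroup G} [R.Normal]
    (hR : ∀ x ∈ wordValues {centerByCenterBy w i j} G, x ∈ R → x = 1) :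
    ⁅⁅verbal {w} G, R⁆, (⊤ : Subgroup G)⁆ = ⊥ := by
  have hX : Disjoint X {i} := by simpa using hi
  have h := commutator_closure_inter_verbal_eq_bot (hw.comm (.var i) hX) (.var j)
    (by simp [hj, hij.symm]) hR
  rw [verbal_of] at h
  refine le_bot_iff.1 (h ▸ Subgroup.commutator_mono ?_ le_rfl)
  have hnormal := trivialValues_normal {commElt w (FreeGroup.of i)} (QuotientGroup.mk' R)
  rw [trivialValues, QuotientGroup.ker_mk'] at hnormal
  conv_lhs => rw [← Subgroup.closure_eq R]
  refine commutator_closure_le fun a ha b hb => commElt_mem_iff.1 (Subgroup.subset_closure ⟨?_, ?_⟩)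
  · exact commElt_mem_wordValues hw (.var i) hX ha (by rw [wordValues_of]; trivial)
  · exact commElt_mem_iff.2 (Subgroup.commutator_le_right ⊤ R
      (Subgroup.commutator_mem_commutator (Subgroup.mem_top a) hb))

theorem commutator_top_verbal_eq_bot {G : Type*} [Group G] {R : Subgroup G} [R.Normal]
    (hR : ∀ x ∈ wordValues {centerByCenterBy w i j} G, x ∈ R → x = 1) :
    ⁅⁅R, (⊤ : Subgroup G)⁆, verbal {w} G⁆ = ⊥ := by
  refine Subgroup.commutator_commutator_eq_bot_of_rotate ?_
    (commutator_verbal_commutator_top_eq_bot hw hi hj hij hR)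
  rw [Subgroup.commutator_comm ⊤]
  exact commutator_commutator_top_eq_bot hw hi hj hij hR

theorem BInvariant.mul_comm' {F G : Type*} [Group F] [Group G] (p : F →* G)
    (x y : BInvariant {centerByCenterBy w i j} p) : x * y = y * x := by
  apply toQuotient_injective
  rw [map_mul, map_mul]
  have hx := (toQuotient_mem _ p x).2
  have hy := (toQuotient_mem _ p y).1
  have : (p.ker.map (QuotientGroup.mk' (trivialValues {centerByCenterBy w i j} p))).Normal :=
    Subgroup.Normal.map inferInstance _ (QuotientGroup.mk'_surjective _)
  rw [verbal_centerByCenterBy hw hi hj hij] at hx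
  have h := commutator_commutator_top_eq_bot hw hi hj hij
    (fun _ => eq_one_of_mem_wordValues_quotient {centerByCenterBy w i j} p)
  rw [Subgroup.commutator_eq_bot_iff_le_centralizer] at h
  exact (Subgroup.mem_centralizer_iff.1 (h (Subgroup.commutator_le_left _ _ hx)) _ hy).symm

theorem BInvariant.finite {F G : Type*} [Group F] [Group G] [Finite G] (p : F →* G) :
    Finite (BInvariant {centerByCenterBy w i j} p) := by
  set f := QuotientGroup.mk' (trivialValues {centerByCenterBy w i j} p)
  have hsurj : Function.Surjective f := QuotientGroup.mk'_surjective _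
  have : (p.ker.map f).Normal := Subgroup.Normal.map inferInstance _ hsurj
  have : (p.ker.map f).FiniteIndex :=
    ⟨fun h => p.ker.index_ne_zero_of_finite
      (Nat.eq_zero_of_zero_dvd (h ▸ Subgroup.index_map_dvd p.ker hsurj))⟩
  have hfin := (hw.centerByCenterBy hi hj hij).finite_verbal (p.ker.map f)
    (fun _ => eq_one_of_mem_wordValues_quotient {centerByCenterBy w i j} p)
  exact Finite.of_injective (fun x => (⟨toQuotient _ p x, (toQuotient_mem _ p x).2⟩ :
    verbal {centerByCenterBy w i j} _))
    fun x y h => toQuotient_injective _ p (congrArg Subtype.val h)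

end Marginal

/-! ### Marginal extensions -/

/-- For an outer commutator word, all arguments may be changed by marginal elements at once. -/
theorem IsOuterCommutator.lift_mul_marginal {v : FreeGroup ℕ} {X : Finset ℕ}
    (hv : IsOuterCommutator v X) {G : Type*} [Group G] (g a : ℕ → G)
    (ha : ∀ k, a k ∈ marginal {v} G) :
    FreeGroup.lift (fun k => g k * a k) v = FreeGroup.lift g v := by
  have h : ∀ Y : Finset ℕ,
      FreeGroup.lift (fun k => if k ∈ Y then g k * a k else g k) v = FreeGroup.lift g v := by
    intro Y
    induction Y using Finset.induction_on with
    | empty => simp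
    | insert m Y hm ih =>
      rw [← ih, ← ha m v rfl (fun k => if k ∈ Y then g k * a k else g k) m]
      congr 2
      funext k
      by_cases hk : k = m
      · subst hk
        simp [hm]
      · simp [hk]
  rw [← h X]
  exact hv.lift_congr fun k hk => (if_pos hk).symm

/-- A trivial value of `v` in the quotient lifts to a trivial value; two lifts differ by marginal
elements, so every value of `v` in the kernel is trivial. -/
theorem eq_one_of_mem_wordValues_of_mem_range {v : FreeGroup ℕ} {X : Finset ℕ}
    (hv : IsOuterCommutator v X) {N E Q : Type*} [Group N] [Group E] [Group Q]
    (S : GroupExtension N E Q) (hS : IsVPExtension {v} S) (hm : S.inl.range ≤ marginal {v} E)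
    {x : E} (hx : x ∈ wordValues {v} E) (hxN : x ∈ S.inl.range) : x = 1 := by
  obtain ⟨_, rfl, g, rfl⟩ := hx
  rw [S.range_inl_eq_ker_rightHom] at hxN hm
  have h : FreeGroup.lift (fun k => S.rightHom (g k)) = S.rightHom.comp (FreeGroup.lift g) := by
    ext k
    simp
  obtain ⟨g', hg', h1⟩ := hS _ rfl (fun k => S.rightHom (g k)) (by rw [h]; exact hxN)
  rw [← h1, ← hv.lift_mul_marginal g' (fun k => (g' k)⁻¹ * g k) fun k => hm ?_]
  · simp
  · rw [MonoidHom.mem_ker, map_mul, map_inv, hg', inv_mul_cancel]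

/-- A central element of the commutator subgroup is in the kernel of the transfer to the
abelianization of `B`, where it is sent to its power with exponent the index of `B`. -/
theorem pow_index_mem_commutator {G : Type*} [Group G] (B : Subgroup G) [B.FiniteIndex] {g : G}
    (hg : g ∈ Subgroup.center G) (hg' : g ∈ commutator G) : g ^ B.index ∈ ⁅B, B⁆ := by
  have key : ∀ (k : ℕ) (g₀ : G), g₀⁻¹ * g ^ k * g₀ ∈ B → g₀⁻¹ * g ^ k * g₀ = g ^ k := by
    intro k g₀ _
    rw [mul_assoc, ← Subgroup.mem_center_iff.1 (pow_mem hg k) g₀, inv_mul_cancel_left]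
  have h1 := MonoidHom.transfer_eq_pow (Abelianization.of : B →* Abelianization B) g key
  have h2 := Abelianization.commutator_subset_ker
    (MonoidHom.transfer (Abelianization.of : B →* Abelianization B)) hg'
  rw [MonoidHom.mem_ker, h1, ← MonoidHom.mem_ker, Abelianization.ker_of] at h2
  rw [← Subgroup.map_subtype_commutator]
  exact ⟨_, h2, rfl⟩

theorem exists_pow_index_eq_mul {G : Type*} [Group G] {B R : Subgroup G} [B.FiniteIndex]
    [R.Normal] (hRB : R ≤ B) {g : G} (hg : g ∈ R) (hg' : g ∈ commutator G) :
    ∃ b ∈ ⁅B, B⁆, ∃ c ∈ ⁅R, (⊤ : Subgroup G)⁆, g ^ B.index = b * c := by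
  set f := QuotientGroup.mk' ⁅R, (⊤ : Subgroup G)⁆ with hf
  have hsurj : Function.Surjective f := QuotientGroup.mk'_surjective _
  have hker : f.ker = ⁅R, (⊤ : Subgroup G)⁆ := QuotientGroup.ker_mk' _
  have hindex : (B.map f).index = B.index :=
    Subgroup.index_map_eq B hsurj (hker.le.trans ((Subgroup.commutator_le_left R ⊤).trans hRB))
  have : (B.map f).FiniteIndex := ⟨hindex ▸ B.index_ne_zero_of_finite⟩
  have hc : f g ∈ Subgroup.center (G ⧸ ⁅R, (⊤ : Subgroup G)⁆) := by
    refine Subgroup.commutator_top_right_eq_bot_iff_le_center.1 ?_ (Subgroup.mem_map_of_mem f hg)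
    rw [← Subgroup.map_top_of_surjective f hsurj, ← Subgroup.map_commutator,
      Subgroup.map_eq_bot_iff, hker]
  have hc' : f g ∈ commutator (G ⧸ ⁅R, (⊤ : Subgroup G)⁆) := by
    rw [commutator_def, ← Subgroup.map_top_of_surjective f hsurj, ← Subgroup.map_commutator]
    exact Subgroup.mem_map_of_mem f hg'
  have h := pow_index_mem_commutator (B.map f) hc hc'
  rw [hindex, ← map_pow, ← Subgroup.map_commutator] at h
  obtain ⟨b, hb, hbg⟩ := h
  refine ⟨b, hb, b⁻¹ * g ^ B.index, ?_, by group⟩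
  rw [← hker, MonoidHom.mem_ker, map_mul, map_inv, hbg, inv_mul_cancel]

theorem exists_pow_eq_of_mem_powers {A : Type*} [Group A] (hA : ∀ x y : A, x * y = y * x) {n : ℕ}
    {a : A} (ha : a ∈ powers A n) : ∃ b, b ^ n = a := by
  induction ha using Subgroup.closure_induction with
  | mem a ha => exact ha
  | one => exact ⟨1, one_pow n⟩
  | mul a b _ _ ha hb =>
    obtain ⟨⟨x, rfl⟩, ⟨y, rfl⟩⟩ := And.intro ha hb
    exact ⟨x * y, Commute.mul_pow (hA x y) n⟩
  | inv a _ ha =>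
    obtain ⟨x, rfl⟩ := ha
    exact ⟨x⁻¹, inv_pow x n⟩

section CenterByCenterBy

variable {w : FreeGroup ℕ} {X : Finset ℕ} (hw : IsOuterCommutator w X)
  {i j : ℕ} (hi : i ∉ X) (hj : j ∉ X) (hij : i ≠ j)

include hw hi hj hij

/-- Modulo the subgroup `[R, G]`, which centralizes `W(G)`, the power of `g` is by transfer in
`[B, B]`, and `[W(B), [B, B]] ≤ V(B)`. -/
theorem commutator_pow_index_mem {G : Type*} [Group G] {R B : Subgroup G} [R.Normal]
    [B.FiniteIndex] (hR : ∀ x ∈ wordValues {centerByCenterBy w i j} G, x ∈ R → x = 1)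
    (hRB : R ≤ B) {g : G} (hg : g ∈ R) (hg' : g ∈ verbal {centerByCenterBy w i j} G) {x : G}
    (hx : x ∈ (verbal {w} B).map B.subtype) :
    ⁅x, g ^ B.index⁆ ∈ (verbal {centerByCenterBy w i j} B).map B.subtype := by
  rw [verbal_centerByCenterBy hw hi hj hij] at hg'
  obtain ⟨b, hb, c, hc, h⟩ := exists_pow_index_eq_mul hRB hg
    (Subgroup.commutator_mono le_top le_rfl hg')
  have hxc : ⁅x, c⁆ = 1 := by
    have h1 := commutator_top_verbal_eq_bot hw hi hj hij hR
    rw [Subgroup.commutator_comm] at h1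
    exact (Subgroup.eq_bot_iff_forall _).1 h1 _
      (Subgroup.commutator_mem_commutator (map_verbal_le _ _ hx) hc)
  rw [h, commutatorElement_mul_right_eq_mul_conj, hxc, mul_one, mul_inv_cancel_right]
  have hle : ⁅verbal {w} B, commutator B⁆ ≤ verbal {centerByCenterBy w i j} B :=
    commutator_commutator_top_le (verbal_centerByCenterBy hw hi hj hij B).ge
  refine Subgroup.map_mono hle ?_
  rw [Subgroup.map_commutator, Subgroup.map_subtype_commutator]
  exact Subgroup.commutator_mem_commutator hx hb

end CenterByCenterBy

/-- Let `R ≤ E` be marginal and without nontrivial values of `v`. Lifting a free presentation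
`q : F → E / R` to `φ : F → E` gives a homomorphism of the `B̃₀`-invariant of `E / R` onto
`R ∩ V(E)`: it is onto since every value in `E`, having marginal ambiguity only, is the image under
`φ` of a value in `F`. -/
theorem exists_hom_range_eq {v : FreeGroup ℕ} {X : Finset ℕ} (hv : IsOuterCommutator v X)
    {E H : Type*} [Group E] [Group H] {R : Subgroup E}
    (hm : R ≤ marginal {v} E) (hR : ∀ x ∈ wordValues {v} E, x ∈ R → x = 1)
    (π : E →* H) (hπ : Function.Surjective π) (hker : π.ker = R)
    {F : Type*} [Group F] [IsFreeGroup F] (q : F →* H) (hq : Function.Surjective q) :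
    ∃ θ : BInvariant {v} q →* E, θ.range = R ⊓ verbal {v} E := by
  choose s hs using hπ
  let φ : F →* E := IsFreeGroup.lift fun x => s (q (IsFreeGroup.of x))
  have hφ : ∀ f, π (φ f) = q f := by
    refine DFunLike.congr_fun (f := π.comp φ) (IsFreeGroup.ext_hom fun x => ?_)
    simp [φ, hs]
  have hφR : ∀ f, φ f ∈ R ↔ f ∈ q.ker := by
    intro f
    rw [← hker, MonoidHom.mem_ker, MonoidHom.mem_ker, hφ]
  have htriv : (trivialValues {v} q).subgroupOf (q.ker ⊓ verbal {v} F) ≤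
      (φ.comp (q.ker ⊓ verbal {v} F).subtype).ker := by
    have h : trivialValues {v} q ≤ φ.ker := (Subgroup.closure_le _).2 fun x hx =>
      hR _ (map_mem_wordValues φ hx.1) ((hφR x).2 hx.2)
    exact fun x hx => h (Subgroup.mem_subgroupOf.1 hx)
  have hverbal : verbal {v} E ≤ (verbal {v} F).map φ := by
    refine (Subgroup.closure_le _).2 ?_
    rintro _ ⟨_, rfl, b, rfl⟩
    choose f hf using fun k => hq (π (b k))
    refine ⟨FreeGroup.lift f _, Subgroup.subset_closure ⟨_, rfl, f, rfl⟩, ?_⟩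
    have h : φ.comp (FreeGroup.lift f) = FreeGroup.lift fun k => φ (f k) := by
      ext k
      simp
    rw [← MonoidHom.comp_apply, h,
      ← hv.lift_mul_marginal (fun k => φ (f k)) (fun k => (φ (f k))⁻¹ * b k) fun k => hm ?_]
    · simp
    · rw [← hker, MonoidHom.mem_ker, map_mul, map_inv, hφ, hf, inv_mul_cancel]
  refine ⟨QuotientGroup.lift _ _ htriv, le_antisymm ?_ ?_⟩
  · rintro _ ⟨x, rfl⟩
    obtain ⟨⟨f, hf⟩, rfl⟩ := QuotientGroup.mk_surjective x
    exact ⟨(hφR f).2 hf.1, map_verbal_le _ φ ⟨f, hf.2, rfl⟩⟩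
  · rintro y ⟨hyR, hyV⟩
    obtain ⟨f, hf, rfl⟩ := hverbal hyV
    exact ⟨QuotientGroup.mk ⟨f, (hφR f).1 hyR, hf⟩, rfl⟩

theorem marginal_subgroupOf_le (V : Set (FreeGroup ℕ)) {G : Type*} [Group G] (B : Subgroup G) :
    (marginal V G).subgroupOf B ≤ marginal V B := by
  intro a ha v hv g k
  have h : ∀ g : ℕ → B,
      ((FreeGroup.lift g v : B) : G) = FreeGroup.lift (fun m => (g m : G)) v := by
    intro g
    have h1 : B.subtype.comp (FreeGroup.lift g) = FreeGroup.lift fun m => (g m : G) := by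
      ext m
      simp
    rw [← h1]
    rfl
  refine Subtype.ext ?_
  rw [h, h, ← Subgroup.mem_subgroupOf.1 ha v hv (fun m => (g m : G)) k]
  congr 2
  funext m
  by_cases hm : m = k
  · subst hm
    simp
  · simp [hm]

end

end VPCover

theorem theorem3p4 {w : FreeGroup ℕ} {X : Finset ℕ} (hw : VPCover.IsOuterCommutator w X)
    {i j : ℕ} (hi : i ∉ X) (hj : j ∉ X) (hij : i ≠ j)
    {G Gs L : Type*} [Group G] [Finite G] [Group Gs] [Group L]
    {F : Type*} [Group F] [IsFreeGroup F] (p : F →* G) (hp : Function.Surjective p)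
    (S : GroupExtension L Gs G)
    (hS : VPCover.IsVPCover {VPCover.centerByCenterBy w i j} S p)
    (H : Subgroup G) (n : ℕ) (hn : H.index = n)
    (B : Subgroup Gs) (hLB : S.inl.range ≤ B)
    (hB : Nonempty (H ≃* B ⧸ S.inl.range.subgroupOf B))
    {F' : Type*} [Group F'] [IsFreeGroup F'] (q : F' →* H) (hq : Function.Surjective q)
    (e : VPCover.BInvariant {VPCover.centerByCenterBy w i j} p ≃* L) :
    ∃ K : Subgroup (VPCover.BInvariant {VPCover.centerByCenterBy w i j} q),
      Nonempty
        (↥⁅(VPCover.verbal {w} B).map B.subtype,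
            (VPCover.powers (VPCover.BInvariant {VPCover.centerByCenterBy w i j} p) n).map
              (S.inl.comp e.toMonoidHom)⁆ ≃* K) := by
  have hv := hw.centerByCenterBy hi hj hij
  have hR : ∀ x ∈ VPCover.wordValues {VPCover.centerByCenterBy w i j} Gs,
      x ∈ S.inl.range → x = 1 := fun x =>
    VPCover.eq_one_of_mem_wordValues_of_mem_range hv S hS.vp hS.le_marginal
  obtain ⟨ι⟩ := hB
  have hGs : S.inl.range.index = Nat.card G := by
    rw [S.range_inl_eq_ker_rightHom, Subgroup.index_ker,
      MonoidHom.range_eq_top.2 S.rightHom_surjective, Subgroup.card_top]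
  have hBL : S.inl.range.relIndex B = Nat.card H := (Nat.card_congr ι.toEquiv).symm
  have hindex : B.index = n := by
    have h := Subgroup.relIndex_mul_index hLB
    rw [hBL, hGs, ← H.card_mul_index, hn] at h
    exact Nat.eq_of_mul_eq_mul_left Nat.card_pos h
  have : B.FiniteIndex := ⟨by rw [hindex, ← hn]; exact H.index_ne_zero_of_finite⟩
  obtain ⟨θ, hθ⟩ := VPCover.exists_hom_range_eq hv (R := S.inl.range.subgroupOf B)
    (fun a ha => VPCover.marginal_subgroupOf_le _ B (hS.le_marginal ha))
    (fun x hx hxL => Subtype.ext (hR x (VPCover.map_mem_wordValues B.subtype hx) hxL))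
    (ι.symm.toMonoidHom.comp (QuotientGroup.mk' _))
    (ι.symm.surjective.comp (QuotientGroup.mk'_surjective _)) (by ext x; simp) q hq
  have hfin : Finite (VPCover.BInvariant {VPCover.centerByCenterBy w i j} q) :=
    VPCover.BInvariant.finite hw hi hj hij q
  have hcomm := VPCover.BInvariant.mul_comm' hw hi hj hij q
  have hcommθ : ∀ x y : θ.range, x * y = y * x := by
    rintro ⟨_, x, rfl⟩ ⟨_, y, rfl⟩
    exact Subtype.ext (by simpa using congrArg θ (hcomm x y))
  let _ : CommGroup (VPCover.BInvariant {VPCover.centerByCenterBy w i j} q) := { mul_comm := hcomm }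
  let _ : CommGroup θ.range := { mul_comm := hcommθ }
  obtain ⟨γ, hγ⟩ := VPCover.exists_injective_of_surjective θ.rangeRestrict
    θ.rangeRestrict_surjective
  have hle : ⁅(VPCover.verbal {w} B).map B.subtype,
      (VPCover.powers (VPCover.BInvariant {VPCover.centerByCenterBy w i j} p) n).map
        (S.inl.comp e.toMonoidHom)⁆ ≤ θ.range.map B.subtype := by
    refine Subgroup.commutator_le.2 ?_
    rintro x hx _ ⟨a, ha, rfl⟩
    obtain ⟨a, rfl⟩ := VPCover.exists_pow_eq_of_mem_powers
      (VPCover.BInvariant.mul_comm' hw hi hj hij p) ha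
    have haL : S.inl (e a) ∈ S.inl.range := ⟨_, rfl⟩
    obtain ⟨y, hy, hyx⟩ := VPCover.commutator_pow_index_mem hw hi hj hij hR hLB haL
      (hS.le_verbal haL) hx
    open scoped commutatorElement in
    have hxy : (y : Gs) = ⁅x, (S.inl.comp e.toMonoidHom) (a ^ n)⁆ := by
      rw [map_pow, ← hindex]
      exact hyx
    have hyL : y ∈ S.inl.range.subgroupOf B := by
      rw [Subgroup.mem_subgroupOf, hxy]
      exact Subgroup.commutator_le_right ⊤ S.inl.range
        (Subgroup.commutator_mem_commutator (Subgroup.mem_top x) ⟨_, rfl⟩)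
    exact ⟨y, hθ.ge ⟨hyL, hy⟩, hxy⟩
  -- `[W(B), Lⁿ]` lies in the image of `θ`, and `γ` embeds that image in the domain of `θ`.
  let δ := (γ.comp
    (θ.range.equivMapOfInjective B.subtype B.subtype_injective).symm.toMonoidHom).comp
    (Subgroup.inclusion hle)
  have hδ : Function.Injective δ := (hγ.comp (MulEquiv.injective _)).comp
    (Subgroup.inclusion_injective hle)
  exact ⟨δ.range, ⟨MonoidHom.ofInjective hδ⟩⟩
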